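/- **Conventions.** For a complex locally convex space $E$ let $E^\star$ be the space of continuous linear functionals with the topology of uniform convergence on totally bounded sets; $E$ is *stereotype* if the canonical map $E\to (E^\star)^\star$ is an isomorphism of topological vector spaces. A *stereotype algebra* is a unital associative algebra $A$ on a stereotype space such that for every compact $K\subseteq A$ and every neighbourhood of zero $U$ there is a neighbourhood of zero $V$ with $K\cdot V\subseteq U$ and $V\cdot K\subseteq U$; it is *involutive* if it carries a continuous conjugate-linear involution with $(ab)^*=b^*a^*$. $\operatorname{Spec}(A)$ is the set of continuous involutive unital characters $t:A\to\mathbb C$ with the topology of uniform convergence on totally bounded sets, and $I_t=\operatorname{Ker} t$. For $A$ commutative, a left $A$-module $X$ on a locally convex space and $n\in\mathbb Z_+$, put $$J^n_t(X)=\bigl(X/\overline{I_t^{\,n+1}\cdot X}\bigr)^{\triangledown},\qquad J^n_A(X)=\bigsqcup_{t\in\operatorname{Spec}(A)}J^n_t(X),\qquad j^n(x)(t)=x+\overline{I_t^{\,n+1}\cdot X},$$ where $\triangledown$ is the pseudocompletion (the least linear subspace of the completion that contains the given space and in which every totally bounded Cauchy net converges), and $J^n_A(X)$ has the topology with base $$W(x,U,p,\varepsilon)=\{\xi:\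 \pi(\xi)\in U,\ p^n_{\pi(\xi)}\bigl(\xi-j^n(x)(\pi(\xi))\bigr)<\varepsilon\},$$ with $x\in X$, $U\subseteq\operatorname{Spec}(A)$ open, $\varepsilon>0$, $p$ a continuous seminorm on $X$, $p^n_t$ the induced (quotient) seminorm on $J^n_t(X)$ and $\pi: J^n_A(X)\to\operatorname{Spec}(A)$ the projection. A *bundle morphism* is a continuous map over $\operatorname{Spec}(A)$ that is linear on each fibre. If $\varphi:A\to B$ is a homomorphism, $B$ is an $A$-module by $a\cdot b=\varphi(a)b$; a *differential operator of order at most $n$* from $A$ to $B$ is a continuous linear map $D:A\to B$ with $[\dots[[D,a_0],a_1]\dots,a_n]=0$ for all $a_0,\dots,a_n\in A$, where $[P,a](x)=P(ax)-\varphi(a)P(x)$. **Theorem.** Let $A$ be a commutative involutive stereotype algebra, $B$ a unital $C^*$-algebra, and $\varphi:A\to B$ a continuous involutive unital homomorphism with $\varphi(A)\subseteq Z(B)$. Let $n\in\mathbb Z_+$. Then for every bundle morphism $\mu:J^n_A(A)\to J^0_A(B)$ there is a unique differential operator $D:A\to B$ of order at most $n$ such that $$j^0(Dx)=\mu\circ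 j^n(x)\qquad\text{for all }x\in A.$$ -/

import Mathlib

open Set Filter Topology

noncomputable section

/-! ### Stereotype spaces and stereotype algebras -/

section Stereotype

variable (E : Type*) [AddCommGroup E] [Module ℂ E] [UniformSpace E]

/-- The stereotype dual `E⋆`: continuous linear functionals on `E` with the topology of uniform
convergence on totally bounded sets. -/
abbrev StereotypeDual : Type _ :=
  UniformConvergenceCLM (RingHom.id ℂ) (E := E) ℂ {S : Set E | TotallyBounded S}

/-- The canonical map `E → E⋆⋆`, `x ↦ (f ↦ f x)`. -/
def stereotypeEval (x : E) : StereotypeDual (StereotypeDual E) :=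
  UniformConvergenceCLM.ofFun (RingHom.id ℂ) ℂ {S : Set (StereotypeDual E) | TotallyBounded S}
    { toFun := fun f => f x
      map_add' := fun _ _ => rfl
      map_smul' := fun _ _ => rfl
      cont := by
        have := UniformConvergenceCLM.continuousEvalConst (RingHom.id ℂ) ℂ
          {S : Set E | TotallyBounded S}
          (eq_univ_of_forall fun y => mem_sUnion.2 ⟨{y}, totallyBounded_singleton y, rfl⟩)
        exact continuous_eval_const (F := StereotypeDual E) x }

/-- A stereotype space: a locally convex space for which the canonical map `E → E⋆⋆` is an
isomorphism (a linear homeomorphism). -/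
structure IsStereotypeSpace : Prop where
  locallyConvex : PolynormableSpace ℂ E
  reflexive : IsHomeomorph (stereotypeEval E)

end Stereotype

/-- A stereotype algebra: a unital associative algebra on a stereotype space, such that for each
compact set `K` and each neighbourhood of zero `U` there is a neighbourhood of zero `V` with
`K · V ⊆ U` and `V · K ⊆ U`. -/
structure IsStereotypeAlgebra (A : Type*) [Ring A] [Algebra ℂ A] [UniformSpace A] : Prop where
  space : IsStereotypeSpace A
  mul : ∀ K : Set A, IsCompact K → ∀ U ∈ 𝓝 (0 : A), ∃ V ∈ 𝓝 (0 : A),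
    (∀ k ∈ K, ∀ v ∈ V, k * v ∈ U) ∧ (∀ k ∈ K, ∀ v ∈ V, v * k ∈ U)

/-! ### Pseudocompletion -/

/-- A subset `S` of a uniform space is pseudocomplete if every totally bounded Cauchy filter
(net) in `S` converges to a point of `S`. -/
def IsPseudocomplete {E : Type*} [UniformSpace E] (S : Set E) : Prop :=
  ∀ T ⊆ S, TotallyBounded T → ∀ F : Filter E, Cauchy F → T ∈ F → ∃ x ∈ S, F ≤ 𝓝 x

section Pseudocompletion

variable (E : Type*) [AddCommGroup E] [Module ℂ E] [UniformSpace E] [IsUniformAddGroup E]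
  [UniformContinuousConstSMul ℂ E]

/-- The pseudocompletion of `E`: the least pseudocomplete linear subspace of the (Hausdorff)
completion of `E` that contains `E`. -/
def pseudoCompletion : Submodule ℂ (UniformSpace.Completion E) :=
  sInf {S | range ((↑) : E → UniformSpace.Completion E) ⊆ S ∧
    IsPseudocomplete (S : Set (UniformSpace.Completion E))}

variable {E} in
/-- The canonical map from `E` to its pseudocompletion. -/
def toPseudoCompletion (x : E) : pseudoCompletion E :=
  ⟨(x : UniformSpace.Completion E),
    (Submodule.mem_sInf).2 fun _ hS => hS.1 (mem_range_self x)⟩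

end Pseudocompletion

/-! ### The involutive spectrum -/

section Spectrum

variable (A : Type*) [CommRing A] [Algebra ℂ A] [StarRing A] [UniformSpace A]

/-- The involutive spectrum `Spec(A)`: continuous involutive unital characters `A → ℂ`. -/
def InvSpec : Type _ := {s : A →⋆ₐ[ℂ] ℂ // Continuous s}

/-- `Spec(A)` carries the topology of uniform convergence on totally bounded sets of `A`. -/
instance : TopologicalSpace (InvSpec A) :=
  TopologicalSpace.induced
    (fun s => UniformOnFun.ofFun {S : Set A | TotallyBounded S} (s.1 : A → ℂ)) inferInstance

variable {A} in
/-- The kernel `I_t` of a character `t`. -/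
def charIdeal (t : InvSpec A) : Ideal A := RingHom.ker t.1

end Spectrum

/-! ### Jet bundles

A left `A`-module structure on the complex vector space `X` is given by the algebra homomorphism
`ρ : A →ₐ[ℂ] Module.End ℂ X`, `a · x = ρ a x`. -/

section Jets

variable {A : Type*} [CommRing A] [Algebra ℂ A] [StarRing A] [UniformSpace A]
variable {X : Type*} [AddCommGroup X] [Module ℂ X] [UniformSpace X] [IsUniformAddGroup X]
  [ContinuousSMul ℂ X]
variable (ρ : A →ₐ[ℂ] Module.End ℂ X) (n : ℕ)

/-- The closed subspace `closure (I_t ^ (n + 1) · X)` of `X`. -/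
def jetKernel (t : InvSpec A) : Submodule ℂ X :=
  (Submodule.span ℂ {y | ∃ a ∈ charIdeal t ^ (n + 1), ∃ x : X, y = ρ a x}).topologicalClosure

/-- The quotient `X / closure (I_t ^ (n + 1) · X)`. -/
def JetQuotient (t : InvSpec A) : Type _ := X ⧸ jetKernel ρ n t

instance (t : InvSpec A) : AddCommGroup (JetQuotient ρ n t) :=
  inferInstanceAs (AddCommGroup (X ⧸ jetKernel ρ n t))

instance (t : InvSpec A) : Module ℂ (JetQuotient ρ n t) :=
  inferInstanceAs (Module ℂ (X ⧸ jetKernel ρ n t))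

/-- The uniform structure of the quotient topology. -/
instance (t : InvSpec A) : UniformSpace (JetQuotient ρ n t) :=
  IsTopologicalAddGroup.rightUniformSpace (X ⧸ jetKernel ρ n t)

instance (t : InvSpec A) : IsUniformAddGroup (JetQuotient ρ n t) :=
  isUniformAddGroup_of_addCommGroup (G := X ⧸ jetKernel ρ n t)

instance (t : InvSpec A) : UniformContinuousConstSMul ℂ (JetQuotient ρ n t) :=
  haveI : ContinuousConstSMul ℂ (JetQuotient ρ n t) :=
    inferInstanceAs (ContinuousConstSMul ℂ (X ⧸ jetKernel ρ n t))
  uniformContinuousConstSMul_of_continuousConstSMul _ _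

/-- The class of `x` in `X / closure (I_t ^ (n + 1) · X)`. -/
def jetMk (t : InvSpec A) (x : X) : JetQuotient ρ n t := (jetKernel ρ n t).mkQ x

/-- The fibre over `t`: the jet module
`J_t^n(X)`, which is the pseudocompletion of `X / closure (I_t ^ (n + 1) · X)`. -/
abbrev JetFiber (t : InvSpec A) : Type _ := pseudoCompletion (JetQuotient ρ n t)

/-- The jet of `x` at `t`, as an element of the fibre over `t`. -/
def jetAt (x : X) (t : InvSpec A) : JetFiber ρ n t := toPseudoCompletion (jetMk ρ n t x)

/-- The quotient seminorm `p(ξ) = inf {p x | x ∈ ξ}` on `X / closure (I_t ^ (n + 1) · X)`. -/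
def quotientSeminorm (p : Seminorm ℂ X) (t : InvSpec A) (ξ : JetQuotient ρ n t) : ℝ :=
  sInf (p '' {x | jetMk ρ n t x = ξ})

/-- The seminorm `p_t^n` on the fibre `J_t^n(X)`: the continuous extension of the quotient seminorm
to the (pseudo)completion. -/
def jetSeminorm (p : Seminorm ℂ X) (t : InvSpec A) (ξ : JetFiber ρ n t) : ℝ :=
  UniformSpace.Completion.extension (quotientSeminorm ρ n p t)
    (ξ : UniformSpace.Completion (JetQuotient ρ n t))

/-- The jet bundle `J_A^n(X)`: the disjoint union of the fibres `J_t^n(X)`, `t ∈ Spec(A)`, with the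
projection `JetBundle.base` onto `Spec(A)`. -/
@[ext]
structure JetBundle where
  base : InvSpec A
  vec : JetFiber ρ n base

/-- The section `j^n(x) : Spec(A) → J_A^n(X)`. -/
def jet (x : X) (t : InvSpec A) : JetBundle ρ n := ⟨t, jetAt ρ n x t⟩

/-- The basic open set `W(x, U, p, ε)` of the jet bundle. -/
def jetBasicOpen (x : X) (U : Set (InvSpec A)) (p : Seminorm ℂ X) (ε : ℝ) : Set (JetBundle ρ n) :=
  {ξ | ξ.base ∈ U ∧ jetSeminorm ρ n p ξ.base (ξ.vec - jetAt ρ n x ξ.base) < ε}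

/-- The topology of the jet bundle, with the base of open sets `W(x, U, p, ε)`, where `x ∈ X`,
`U ⊆ Spec(A)` is open, `p` is a continuous seminorm on `X` and `ε > 0`. -/
instance : TopologicalSpace (JetBundle ρ n) :=
  TopologicalSpace.generateFrom
    {W | ∃ (x : X) (U : Set (InvSpec A)) (p : Seminorm ℂ X) (ε : ℝ),
      IsOpen U ∧ Continuous p ∧ 0 < ε ∧ W = jetBasicOpen ρ n x U p ε}

end Jets

section Operators

variable {A : Type*} [CommRing A] [Algebra ℂ A] [StarRing A] [UniformSpace A]
variable {X : Type*} [AddCommGroup X] [Module ℂ X] [UniformSpace X] [IsUniformAddGroup X]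
  [ContinuousSMul ℂ X]
variable {Y : Type*} [AddCommGroup Y] [Module ℂ Y] [UniformSpace Y] [IsUniformAddGroup Y]
  [ContinuousSMul ℂ Y]

/-- A morphism of jet bundles `J_A^n(X) → J_A^m(Y)`: a continuous map over `Spec(A)` that is linear
on each fibre. -/
structure JetBundleHom (ρ : A →ₐ[ℂ] Module.End ℂ X) (n : ℕ) (τ : A →ₐ[ℂ] Module.End ℂ Y) (m : ℕ)
    where
  toFun : JetBundle ρ n → JetBundle τ m
  fiberMap : ∀ t : InvSpec A, JetFiber ρ n t →ₗ[ℂ] JetFiber τ m t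
  toFun_mk : ∀ (t : InvSpec A) (ξ : JetFiber ρ n t), toFun ⟨t, ξ⟩ = ⟨t, fiberMap t ξ⟩
  continuous_toFun : Continuous toFun

/-- The commutator `[P, a](x) = P (a · x) - a · P x`. -/
def moduleCommutator (ρ : A →ₐ[ℂ] Module.End ℂ X) (τ : A →ₐ[ℂ] Module.End ℂ Y)
    (P : X →ₗ[ℂ] Y) (a : A) : X →ₗ[ℂ] Y :=
  P ∘ₗ ρ a - τ a ∘ₗ P

/-- `D` is a differential operator of order at most `n`: `D` is linear and continuous, and
`[...[[D, a_0], a_1], ..., a_n] = 0` for all `a_0, ..., a_n ∈ A`. -/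
def IsDiffOp (ρ : A →ₐ[ℂ] Module.End ℂ X) (τ : A →ₐ[ℂ] Module.End ℂ Y) (n : ℕ)
    (D : X →L[ℂ] Y) : Prop :=
  ∀ l : List A, l.length = n + 1 →
    l.foldl (moduleCommutator ρ τ) (D : X →ₗ[ℂ] Y) = 0

end Operators

/-- The algebra `A` as a left module over itself. -/
abbrev selfAction (A : Type*) [CommRing A] [Algebra ℂ A] : A →ₐ[ℂ] Module.End ℂ A :=
  Algebra.lmul ℂ A

/-- The left `A`-module structure `a · y = φ(a) y` on `B` given by a homomorphism `φ : A → B`. -/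
abbrev pullbackAction {A B : Type*} [CommRing A] [Algebra ℂ A] [StarRing A] [CStarAlgebra B]
    (φ : A →⋆ₐ[ℂ] B) : A →ₐ[ℂ] Module.End ℂ B :=
  (Algebra.lmul ℂ B).comp φ.toAlgHom

end

/-! The bundle `J_A^0(B)` represents `B` as its algebra of continuous sections, in the manner of
Dauns–Hofmann. The fibre over `t` is `B` modulo the closed two-sided star ideal generated by
`φ(I_t)`. It vanishes unless `t` is restricted from a character of the commutative C⋆-algebra `E`
obtained by closing `φ(A)`, and the character space of `E` is compact.

Two facts carry the proof. By `norm_le_of_fiberSeminorm_le`, fibre norms control the norm of `B`, so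
an element is determined by its jets. By `exists_jetAt_eq_of_continuous`, every continuous section
is a jet: partitions of unity on the character space glue local approximations, and completeness
gives the limit.

Now `μ ∘ j^n(x)` is a continuous section, hence the jet of a unique `D x`, linear in `x` by
uniqueness. Continuity of `D` follows from joint continuity of `(x, t) ↦ j^n(x)(t)` and compactness.
Modulo the kernel at `t`, an `(n+1)`-fold commutator of `D` is `D` applied to an element of
`I_t^{n+1} · A`; the `n`-jet of that element at `t` is zero, so the commutator vanishes in every
fibre. -/

noncomputable section

/-! ### Fibre seminorms and continuity of jets -/

section JetFibers

variable {A : Type*} [CommRing A] [Algebra ℂ A] [StarRing A] [UniformSpace A]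
variable {X : Type*} [AddCommGroup X] [Module ℂ X] [UniformSpace X] [IsUniformAddGroup X]
  [ContinuousSMul ℂ X]
variable (ρ : A →ₐ[ℂ] Module.End ℂ X) (n : ℕ)

theorem InvSpec.continuous_apply (a : A) : Continuous fun t : InvSpec A => t.1 a :=
  (UniformOnFun.uniformContinuous_eval_of_mem (β := ℂ) {S : Set A | TotallyBounded S}
    (mem_singleton a) (totallyBounded_singleton a)).continuous.comp continuous_induced_dom

theorem jetMk_surjective (t : InvSpec A) : Function.Surjective (jetMk ρ n t) :=
  (jetKernel ρ n t).mkQ_surjective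

theorem jetMk_eq_iff {t : InvSpec A} {x y : X} :
    jetMk ρ n t x = jetMk ρ n t y ↔ x - y ∈ jetKernel ρ n t :=
  Submodule.Quotient.eq _

theorem jetMk_add (t : InvSpec A) (x y : X) :
    jetMk ρ n t (x + y) = jetMk ρ n t x + jetMk ρ n t y := rfl

theorem jetMk_smul (t : InvSpec A) (c : ℂ) (x : X) :
    jetMk ρ n t (c • x) = c • jetMk ρ n t x := rfl

theorem jetAt_add (t : InvSpec A) (x y : X) :
    jetAt ρ n (x + y) t = jetAt ρ n x t + jetAt ρ n y t :=
  Subtype.ext (UniformSpace.Completion.coe_add (jetMk ρ n t x) (jetMk ρ n t y))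

theorem jetAt_zero (t : InvSpec A) : jetAt ρ n (0 : X) t = 0 :=
  Subtype.ext (UniformSpace.Completion.coe_zero (α := JetQuotient ρ n t))

theorem jetAt_sub (t : InvSpec A) (x y : X) :
    jetAt ρ n (x - y) t = jetAt ρ n x t - jetAt ρ n y t :=
  Subtype.ext (UniformSpace.Completion.coe_sub (jetMk ρ n t x) (jetMk ρ n t y))

theorem jetAt_smul (t : InvSpec A) (c : ℂ) (x : X) :
    jetAt ρ n (c • x) t = c • jetAt ρ n x t :=
  Subtype.ext (UniformSpace.Completion.coe_smul c (jetMk ρ n t x))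

theorem jetAt_eq_of_sub_mem {t : InvSpec A} {x y : X} (h : x - y ∈ jetKernel ρ n t) :
    jetAt ρ n x t = jetAt ρ n y t := by
  unfold jetAt
  rw [(jetMk_eq_iff ρ n).2 h]

theorem mem_jetKernel_of_mem_pow {t : InvSpec A} {a : A} (ha : a ∈ charIdeal t ^ (n + 1)) (x : X) :
    ρ a x ∈ jetKernel ρ n t :=
  Submodule.le_topologicalClosure _ (Submodule.subset_span ⟨a, ha, x, rfl⟩)

theorem quotientSeminorm_lt_iff (p : Seminorm ℂ X) (t : InvSpec A) (ξ : JetQuotient ρ n t)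
    {ε : ℝ} : quotientSeminorm ρ n p t ξ < ε ↔ ∃ x, jetMk ρ n t x = ξ ∧ p x < ε := by
  obtain ⟨x, hx⟩ := jetMk_surjective ρ n t ξ
  unfold quotientSeminorm
  have hb : BddBelow (p '' {x | jetMk ρ n t x = ξ}) :=
    ⟨0, by rintro _ ⟨y, -, rfl⟩; exact apply_nonneg p y⟩
  have hne : (p '' {x | jetMk ρ n t x = ξ}).Nonempty := ⟨p x, x, hx, rfl⟩
  rw [csInf_lt_iff hb hne]
  simp

theorem quotientSeminorm_mk_le (p : Seminorm ℂ X) (t : InvSpec A) (x : X) :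
    quotientSeminorm ρ n p t (jetMk ρ n t x) ≤ p x :=
  csInf_le ⟨0, by rintro _ ⟨y, -, rfl⟩; exact apply_nonneg p y⟩ ⟨x, rfl, rfl⟩

/-- The quotient seminorm as a `Seminorm`. -/
def quotientSeminormAux (p : Seminorm ℂ X) (t : InvSpec A) : Seminorm ℂ (JetQuotient ρ n t) :=
  Seminorm.ofSMulLE (quotientSeminorm ρ n p t)
    (le_antisymm ((quotientSeminorm_mk_le ρ n p t 0).trans_eq (map_zero p))
      (Real.sInf_nonneg (by rintro _ ⟨y, -, rfl⟩; exact apply_nonneg p y)))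
    (fun ξ η => by
      refine le_of_forall_pos_lt_add fun ε hε => ?_
      obtain ⟨x, hx, hpx⟩ := (quotientSeminorm_lt_iff ρ n p t ξ).1
        (lt_add_of_pos_right _ (half_pos hε))
      obtain ⟨y, hy, hpy⟩ := (quotientSeminorm_lt_iff ρ n p t η).1
        (lt_add_of_pos_right _ (half_pos hε))
      refine (quotientSeminorm_lt_iff ρ n p t _).2 ⟨x + y, by rw [jetMk_add, hx, hy], ?_⟩
      linarith [map_add_le_add p x y])
    (fun c ξ => by
      refine le_of_forall_pos_lt_add fun ε hε => ?_
      -- The summand 1 covers `c = 0`.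
      have hc : 0 < ‖c‖ + 1 := by positivity
      obtain ⟨x, hx, hpx⟩ := (quotientSeminorm_lt_iff ρ n p t ξ).1
        (lt_add_of_pos_right _ (div_pos hε hc))
      refine (quotientSeminorm_lt_iff ρ n p t _).2 ⟨c • x, by rw [jetMk_smul, hx], ?_⟩
      rw [map_smul_eq_mul]
      have h1 : ‖c‖ * p x ≤ ‖c‖ * (quotientSeminorm ρ n p t ξ + ε / (‖c‖ + 1)) := by gcongr
      have h2 : ‖c‖ * (ε / (‖c‖ + 1)) < ε := by
        rw [mul_div_assoc', div_lt_iff₀ hc]; nlinarith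
      linarith)

theorem uniformContinuous_quotientSeminorm {p : Seminorm ℂ X} (hp : Continuous p)
    (t : InvSpec A) : UniformContinuous (quotientSeminorm ρ n p t) := by
  refine Seminorm.uniformContinuous_of_continuousAt_zero (p := quotientSeminormAux ρ n p t) ?_
  refine Continuous.continuousAt ?_
  refine (jetKernel ρ n t).isOpenQuotientMap_mkQ.isQuotientMap.continuous_iff.2 ?_
  exact Seminorm.continuous_of_le (p := (quotientSeminormAux ρ n p t).comp (jetKernel ρ n t).mkQ) hp
    fun x => quotientSeminorm_mk_le ρ n p t x

theorem jetSeminorm_jetAt {p : Seminorm ℂ X} (hp : Continuous p) (t : InvSpec A) (x : X) :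
    jetSeminorm ρ n p t (jetAt ρ n x t) = quotientSeminorm ρ n p t (jetMk ρ n t x) :=
  UniformSpace.Completion.extension_coe (uniformContinuous_quotientSeminorm ρ n hp t) _

/-- The seminorm `x ↦ p_t^n(j^n(x)(t))` on `X`. -/
def fiberSeminorm (p : Seminorm ℂ X) (t : InvSpec A) : Seminorm ℂ X :=
  (quotientSeminormAux ρ n p t).comp (jetKernel ρ n t).mkQ

theorem fiberSeminorm_eq (p : Seminorm ℂ X) (t : InvSpec A) (x : X) :
    fiberSeminorm ρ n p t x = quotientSeminorm ρ n p t (jetMk ρ n t x) := rfl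

theorem jetSeminorm_jetAt_sub {p : Seminorm ℂ X} (hp : Continuous p) (t : InvSpec A) (x y : X) :
    jetSeminorm ρ n p t (jetAt ρ n x t - jetAt ρ n y t) = fiberSeminorm ρ n p t (x - y) := by
  rw [← jetAt_sub, jetSeminorm_jetAt ρ n hp, fiberSeminorm_eq]

theorem fiberSeminorm_lt_iff (p : Seminorm ℂ X) (t : InvSpec A) (x : X) {ε : ℝ} :
    fiberSeminorm ρ n p t x < ε ↔ ∃ y ∈ jetKernel ρ n t, p (x + y) < ε := by
  rw [fiberSeminorm_eq, quotientSeminorm_lt_iff]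
  constructor
  · rintro ⟨y, hy, hp⟩
    exact ⟨y - x, (jetMk_eq_iff ρ n).1 hy, by simpa using hp⟩
  · rintro ⟨y, hy, hp⟩
    exact ⟨x + y, (jetMk_eq_iff ρ n).2 (by simpa using hy), hp⟩

theorem fiberSeminorm_le (p : Seminorm ℂ X) (t : InvSpec A) (x : X) :
    fiberSeminorm ρ n p t x ≤ p x :=
  quotientSeminorm_mk_le ρ n p t x

theorem fiberSeminorm_eq_zero_of_mem (p : Seminorm ℂ X) {t : InvSpec A} {x : X}
    (hx : x ∈ jetKernel ρ n t) : fiberSeminorm ρ n p t x = 0 := by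
  refine le_antisymm (le_of_forall_pos_lt_add fun ε hε => ?_) (apply_nonneg _ _)
  exact (fiberSeminorm_lt_iff ρ n p t x).2 ⟨-x, neg_mem hx, by simpa using hε⟩

theorem fiberSeminorm_eq_of_sub_mem (p : Seminorm ℂ X) {t : InvSpec A} {x y : X}
    (h : x - y ∈ jetKernel ρ n t) : fiberSeminorm ρ n p t x = fiberSeminorm ρ n p t y := by
  rw [fiberSeminorm_eq, fiberSeminorm_eq, (jetMk_eq_iff ρ n).2 h]

/-- Elements of `I_{t₀} ^ m` extend to families `s ↦ α s ∈ I_s ^ m`, continuous on each vector. -/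
theorem exists_continuous_family_pow (t₀ : InvSpec A) (m : ℕ) {a : A} (ha : a ∈ charIdeal t₀ ^ m) :
    ∃ α : InvSpec A → A, α t₀ = a ∧ (∀ s, α s ∈ charIdeal s ^ m) ∧
      ∀ x : X, Continuous fun s => ρ (α s) x := by
  induction m generalizing a with
  | zero => exact ⟨fun _ => a, rfl, fun s => by simp, fun x => continuous_const⟩
  | succ m ih =>
    rw [pow_succ] at ha
    induction ha using Submodule.mul_induction_on' with
    | mem_mul_mem b hb c hc =>
      obtain ⟨β, hβ, hβm, hβc⟩ := ih hb
      -- The factor `c` is corrected to `c - s(c)`, which lies in `I_s` and is `c` itself at `t₀`.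
      refine ⟨fun s => β s * (c - algebraMap ℂ A (s.1 c)), ?_, fun s => ?_, fun x => ?_⟩
      · have hc' : t₀.1 c = 0 := hc
        simp [hβ, hc']
      · rw [pow_succ]
        refine Ideal.mul_mem_mul (hβm s) ?_
        change s.1 (c - algebraMap ℂ A (s.1 c)) = 0
        rw [map_sub, AlgHomClass.commutes]
        exact sub_self _
      -- No continuity of `ρ` is assumed; after expansion `s` enters only through the scalar `s(c)`
      -- and through `β`, which is evaluated at fixed vectors.
      · have h : ∀ s : InvSpec A, ρ (β s * (c - algebraMap ℂ A (s.1 c))) x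
            = ρ (β s) (ρ c x) - s.1 c • ρ (β s) x := fun s => by
          rw [map_mul, map_sub, AlgHom.commutes, Module.End.mul_apply, LinearMap.sub_apply,
            map_sub, Module.algebraMap_end_apply, map_smul]
        simp only [h]
        exact (hβc _).sub ((InvSpec.continuous_apply c).smul (hβc x))
    | add b _ c _ hb hc =>
      obtain ⟨β, hβ, hβm, hβc⟩ := hb
      obtain ⟨γ, hγ, hγm, hγc⟩ := hc
      refine ⟨fun s => β s + γ s, by simp only [hβ, hγ], fun s => add_mem (hβm s) (hγm s), fun x => ?_⟩
      simp only [map_add, LinearMap.add_apply]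
      exact (hβc x).add (hγc x)

/-- Finite sums of generators move continuously with the base point while staying in the moving
kernels. Limits are excluded here; upper semicontinuity needs only the dense span. -/
theorem exists_continuous_section_span (t₀ : InvSpec A) {z : X}
    (hz : z ∈ Submodule.span ℂ {y | ∃ a ∈ charIdeal t₀ ^ (n + 1), ∃ x : X, y = ρ a x}) :
    ∃ ζ : InvSpec A → X, ζ t₀ = z ∧ Continuous ζ ∧ ∀ s, ζ s ∈ jetKernel ρ n s := by
  induction hz using Submodule.span_induction with
  | mem y hy =>
    obtain ⟨a, ha, x, rfl⟩ := hy
    obtain ⟨α, rfl, hα, hc⟩ := exists_continuous_family_pow ρ t₀ (n + 1) ha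
    exact ⟨fun s => ρ (α s) x, rfl, hc x, fun s => mem_jetKernel_of_mem_pow ρ n (hα s) x⟩
  | zero => exact ⟨fun _ => 0, rfl, continuous_const, fun s => zero_mem _⟩
  | add y z _ _ hy hz =>
    obtain ⟨η, rfl, hη, hη'⟩ := hy
    obtain ⟨ζ, rfl, hζ, hζ'⟩ := hz
    exact ⟨fun s => η s + ζ s, rfl, hη.add hζ, fun s => add_mem (hη' s) (hζ' s)⟩
  | smul c y _ hy =>
    obtain ⟨η, rfl, hη, hη'⟩ := hy
    exact ⟨fun s => c • η s, rfl, hη.const_smul c, fun s => Submodule.smul_mem _ c (hη' s)⟩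

/-- Upper semicontinuity of `(x, t) ↦ p_t^n(j^n(x)(t))`. -/
theorem isOpen_fiberSeminorm_lt {p : Seminorm ℂ X} (hp : Continuous p) (ε : ℝ) :
    IsOpen {z : X × InvSpec A | fiberSeminorm ρ n p z.2 z.1 < ε} := by
  rw [isOpen_iff_mem_nhds]
  rintro ⟨x, t⟩ hx
  obtain ⟨y, hy, hpy⟩ := (fiberSeminorm_lt_iff ρ n p t x).1 hx
  have ho : IsOpen {y | p (x + y) < ε} :=
    isOpen_lt (hp.comp (continuous_const.add continuous_id)) continuous_const
  -- The strict inequality is open, so the correction `y` can be taken in the span before closure,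
  -- where it extends to nearby points.
  obtain ⟨z, hz, hzs⟩ := mem_closure_iff.1 hy _ ho hpy
  obtain ⟨ζ, rfl, hζ, hζ'⟩ := exists_continuous_section_span ρ n t hzs
  have ho' : IsOpen {w : X × InvSpec A | p (w.1 + ζ w.2) < ε} :=
    isOpen_lt (hp.comp (continuous_fst.add (hζ.comp continuous_snd))) continuous_const
  filter_upwards [ho'.mem_nhds (x := (x, t)) hz] with w hw
  exact (fiberSeminorm_lt_iff ρ n p w.2 w.1).2 ⟨_, hζ' w.2, hw⟩

theorem continuous_jet : Continuous fun z : X × InvSpec A => jet ρ n z.1 z.2 := by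
  refine continuous_generateFrom_iff.2 ?_
  rintro _ ⟨y, U, p, ε, hU, hp, -, rfl⟩
  have : (fun z : X × InvSpec A => jet ρ n z.1 z.2) ⁻¹' jetBasicOpen ρ n y U p ε =
      Prod.snd ⁻¹' U ∩ (fun z => (z.1 - y, z.2)) ⁻¹'
        {z : X × InvSpec A | fiberSeminorm ρ n p z.2 z.1 < ε} := by
    ext z
    simp [jet, jetBasicOpen, jetSeminorm_jetAt_sub ρ n hp]
  rw [this]
  exact (hU.preimage continuous_snd).inter ((isOpen_fiberSeminorm_lt ρ n hp ε).preimage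
    ((continuous_fst.sub continuous_const).prodMk continuous_snd))

theorem isOpen_jetBasicOpen (x : X) {U : Set (InvSpec A)} (hU : IsOpen U) {p : Seminorm ℂ X}
    (hp : Continuous p) {ε : ℝ} (hε : 0 < ε) : IsOpen (jetBasicOpen ρ n x U p ε) :=
  TopologicalSpace.isOpen_generateFrom_of_mem ⟨x, U, p, ε, hU, hp, hε, rfl⟩

/-- Over a complete metrizable module the pseudocompletion adds nothing to the fibres. -/
theorem jetAt_surjective [FirstCountableTopology X] [CompleteSpace X] (t : InvSpec A)
    (ξ : JetFiber ρ n t) : ∃ x : X, jetAt ρ n x t = ξ := by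
  -- First countability makes the quotient complete, so its image in the completion is closed as
  -- well as dense.
  have hcs : CompleteSpace (JetQuotient ρ n t) :=
    QuotientAddGroup.completeSpace_right X (jetKernel ρ n t).toAddSubgroup
  have hrange : range ((↑) : JetQuotient ρ n t → UniformSpace.Completion (JetQuotient ρ n t))
      = univ := by
    rw [← (UniformSpace.Completion.denseRange_coe (α := JetQuotient ρ n t)).closure_range]
    exact (UniformSpace.Completion.isUniformInducing_coe
      _).isComplete_range.isClosed.closure_eq.symm
  obtain ⟨η, hη⟩ := hrange.ge (mem_univ (ξ : UniformSpace.Completion (JetQuotient ρ n t)))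
  obtain ⟨x, rfl⟩ := jetMk_surjective ρ n t η
  exact ⟨x, Subtype.ext hη⟩

end JetFibers

/-! ### Iterated commutators modulo the kernel at a point -/

section Operators

variable {A : Type*} [CommRing A] [Algebra ℂ A] [StarRing A] [UniformSpace A]
variable {X : Type*} [AddCommGroup X] [Module ℂ X]
variable {Y : Type*} [AddCommGroup Y] [Module ℂ Y] [UniformSpace Y] [IsUniformAddGroup Y]
  [ContinuousSMul ℂ Y]
variable (ρ : A →ₐ[ℂ] Module.End ℂ X) (τ : A →ₐ[ℂ] Module.End ℂ Y)

theorem sub_algebraMap_mem_charIdeal (t : InvSpec A) (a : A) :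
    a - algebraMap ℂ A (t.1 a) ∈ charIdeal t := by
  change t.1 (a - algebraMap ℂ A (t.1 a)) = 0
  rw [map_sub, AlgHomClass.commutes]
  exact sub_self _

/-- The difference is `-(a - t(a)) · P x`, and `a - t(a)` lies in `I_t`. -/
theorem moduleCommutator_sub_mem (P : X →ₗ[ℂ] Y) (a : A) (t : InvSpec A) (x : X) :
    moduleCommutator ρ τ P a x - P (ρ (a - algebraMap ℂ A (t.1 a)) x) ∈ jetKernel τ 0 t := by
  have h : moduleCommutator ρ τ P a x - P (ρ (a - algebraMap ℂ A (t.1 a)) x)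
      = -τ (a - algebraMap ℂ A (t.1 a)) (P x) := by
    simp [moduleCommutator, map_sub, Module.algebraMap_end_apply]
  rw [h]
  exact neg_mem (mem_jetKernel_of_mem_pow τ 0 (by simpa using sub_algebraMap_mem_charIdeal t a) _)

/-- Iterated commutators at `t`: modulo `closure (I_t · Y)`, the operator `[…[P, a_0], …, a_m]` is
`x ↦ P (∏ (a_i - t(a_i)) x)`. -/
theorem foldl_moduleCommutator_sub_mem (t : InvSpec A) (l : List A) (P : X →ₗ[ℂ] Y) :
    ∃ a ∈ charIdeal t ^ l.length,
      ∀ x, l.foldl (moduleCommutator ρ τ) P x - P (ρ a x) ∈ jetKernel τ 0 t := by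
  induction l generalizing P with
  | nil => exact ⟨1, by simp, fun x => by simp⟩
  | cons b l ih =>
    obtain ⟨a, ha, h⟩ := ih (moduleCommutator ρ τ P b)
    refine ⟨(b - algebraMap ℂ A (t.1 b)) * a, ?_, fun x => ?_⟩
    · rw [List.length_cons, pow_succ']
      exact Ideal.mul_mem_mul (sub_algebraMap_mem_charIdeal t b) ha
    · have := add_mem (h x) (moduleCommutator_sub_mem ρ τ P b t (ρ a x))
      rw [sub_add_sub_cancel] at this
      rwa [map_mul]

end Operators

/-! ### Commutative C⋆-subalgebras and Gelfand theory -/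

section CommutativeSubalgebras

universe u

/-- A closed commutative star subalgebra of a C⋆-algebra is a commutative C⋆-algebra. -/
abbrev StarSubalgebra.commCStarAlgebraOfCommute {B : Type u} [CStarAlgebra B]
    (S : StarSubalgebra ℂ B) (hc : IsClosed (S : Set B)) (h : ∀ x ∈ S, ∀ y ∈ S, x * y = y * x) :
    CommCStarAlgebra S :=
  { StarSubalgebra.cstarAlgebra (h_closed := hc) S with
    mul_comm := fun x y => Subtype.ext (h x x.2 y y.2) }

/-- A star-closed set of commuting elements of a C⋆-algebra generates a commutative C⋆-algebra,
given here by an isometric star homomorphism onto the closure of the generated star subalgebra. -/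
theorem exists_commCStarAlgebra_adjoin {B : Type u} [CStarAlgebra B] (s : Set B)
    (hs : ∀ x ∈ s, star x ∈ s) (hcomm : ∀ x ∈ s, ∀ y ∈ s, x * y = y * x) :
    ∃ (E : Type u) (_ : CommCStarAlgebra E) (ι : E →⋆ₐ[ℂ] B), Isometry ι ∧
      range ι = closure (StarAlgebra.adjoin ℂ s : Set B) := by
  have h : IsMulCommutative (StarAlgebra.adjoin ℂ s) :=
    StarAlgebra.isMulCommutative_adjoin ℂ hcomm fun x hx y hy => hcomm x hx _ (hs y hy)
  let i := (StarAlgebra.adjoin ℂ s).commRingTopologicalClosure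
    (fun x y => h.is_comm.comm x y)
  let S := (StarAlgebra.adjoin ℂ s).topologicalClosure
  have hcl : IsClosed (S : Set B) := StarSubalgebra.isClosed_topologicalClosure _
  refine ⟨S, S.commCStarAlgebraOfCommute hcl fun x hx y hy =>
    congrArg Subtype.val (i.mul_comm ⟨x, hx⟩ ⟨y, hy⟩), S.subtype, isometry_subtype_coe, ?_⟩
  exact Subtype.range_coe

theorem StarAlgHom.exists_lift {A E B : Type*} [Semiring A] [Algebra ℂ A] [Star A]
    [Semiring E] [Algebra ℂ E] [Star E] [Semiring B] [Algebra ℂ B] [Star B]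
    (ι : E →⋆ₐ[ℂ] B) (hι : Function.Injective ι) (φ : A →⋆ₐ[ℂ] B) (h : range φ ⊆ range ι) :
    ∃ ψ : A →⋆ₐ[ℂ] E, ∀ a, ι (ψ a) = φ a := by
  choose ψ hψ using fun a => h (mem_range_self a)
  exact ⟨{  toFun := ψ
            map_one' := hι (by simp only [hψ, map_one])
            map_mul' := fun a b => hι (by simp only [hψ, map_mul])
            map_zero' := hι (by simp only [hψ, map_zero])
            map_add' := fun a b => hι (by simp only [hψ, map_add])
            commutes' := fun c => hι (by simp only [hψ, AlgHomClass.commutes])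
            map_star' := fun a => hι (by simp only [hψ, map_star]) }, hψ⟩

/-- The Gelfand transform is isometric and its supremum is attained on the compact, nonempty
character space. -/
theorem CommCStarAlgebra.exists_character_norm_eq {E : Type*} [CommCStarAlgebra E] [Nontrivial E]
    (e : E) : ∃ k : WeakDual.characterSpace ℂ E, ‖k e‖ = ‖e‖ := by
  have h : ‖WeakDual.gelfandTransform ℂ E e‖ = ‖e‖ :=
    (gelfandTransform_isometry E).norm_map_of_map_zero (map_zero _) e
  obtain ⟨k, -, hk⟩ := isCompact_univ.exists_isMaxOn
    (univ_nonempty (α := WeakDual.characterSpace ℂ E))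
    (map_continuous (WeakDual.gelfandTransform ℂ E e)).norm.continuousOn
  refine ⟨k, le_antisymm ?_ ?_⟩
  · rw [← h]
    exact ContinuousMap.norm_coe_le_norm (WeakDual.gelfandTransform ℂ E e) k
  · rw [← h]
    exact (ContinuousMap.norm_le _ (norm_nonneg _)).2 fun l => hk (mem_univ l)

theorem CommCStarAlgebra.norm_character_apply_le {E : Type*} [CommCStarAlgebra E]
    (k : WeakDual.characterSpace ℂ E) (e : E) : ‖k e‖ ≤ ‖e‖ := by
  have h : ‖WeakDual.gelfandTransform ℂ E e‖ = ‖e‖ :=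
    (gelfandTransform_isometry E).norm_map_of_map_zero (map_zero _) e
  rw [← h]
  exact ContinuousMap.norm_coe_le_norm (WeakDual.gelfandTransform ℂ E e) k

/-- An element of a commutative C⋆-algebra peaking at a character and small against a given element
annihilated by the character. -/
theorem CommCStarAlgebra.exists_peak {E : Type*} [CommCStarAlgebra E]
    (k : WeakDual.characterSpace ℂ E) {u : E} (hu : k u = 0) {δ : ℝ} (hδ : 0 < δ) :
    ∃ e : E, ‖e‖ ≤ 1 ∧ k e = 1 ∧ ‖e * u‖ ≤ δ := by
  have hnorm : ∀ e : E, ‖gelfandStarTransform E e‖ = ‖e‖ := fun e =>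
    (gelfandTransform_isometry E).norm_map_of_map_zero (map_zero _) e
  have happ : ∀ (e : E) l, gelfandStarTransform E e l = l e := fun e l => rfl
  have hpos : ∀ l : WeakDual.characterSpace ℂ E, 0 < δ + ‖l u‖ := fun l => by positivity
  -- `δ / (δ + |u|)` is at most 1, equals 1 where `u` vanishes, and has product at most `δ` with
  -- `|u|`.
  let f : C(WeakDual.characterSpace ℂ E, ℂ) :=
    ⟨fun l => ((δ / (δ + ‖l u‖) : ℝ) : ℂ), by
      refine Complex.continuous_ofReal.comp (continuous_const.div ?_ fun l => (hpos l).ne')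
      exact continuous_const.add (map_continuous (gelfandStarTransform E u)).norm⟩
  have hf : ∀ l, ‖f l‖ = δ / (δ + ‖l u‖) := fun l => by
    change ‖((δ / (δ + ‖l u‖) : ℝ) : ℂ)‖ = _
    rw [Complex.norm_real, Real.norm_of_nonneg (div_nonneg hδ.le (hpos l).le)]
  refine ⟨(gelfandStarTransform E).symm f, ?_, ?_, ?_⟩
  · rw [← hnorm, StarAlgEquiv.apply_symm_apply, ContinuousMap.norm_le _ zero_le_one]
    intro l
    rw [hf, div_le_one (hpos l)]
    linarith [norm_nonneg (l u)]
  · rw [← happ, StarAlgEquiv.apply_symm_apply]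
    change ((δ / (δ + ‖k u‖) : ℝ) : ℂ) = 1
    rw [hu, norm_zero, add_zero, div_self hδ.ne', Complex.ofReal_one]
  · rw [← hnorm, map_mul, StarAlgEquiv.apply_symm_apply, ContinuousMap.norm_le _ hδ.le]
    intro l
    rw [ContinuousMap.mul_apply, norm_mul, hf, happ, div_mul_eq_mul_div, div_le_iff₀ (hpos l)]
    nlinarith [norm_nonneg (l u)]

end CommutativeSubalgebras

/-! ### Kernels of a central homomorphism and restricted characters -/

section CentralHom

variable {A : Type*} [CommRing A] [Algebra ℂ A] [StarRing A] [UniformSpace A]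
variable {B : Type*} [CStarAlgebra B] {φ : A →⋆ₐ[ℂ] B}

theorem jetKernel_pullback_induction {t : InvSpec A} {P : B → Prop}
    (mem : ∀ a ∈ charIdeal t, ∀ y, P (φ a * y)) (zero : P 0)
    (add : ∀ x y, P x → P y → P (x + y)) (smul : ∀ (c : ℂ) x, P x → P (c • x))
    (closed : IsClosed {x | P x}) {x : B} (hx : x ∈ jetKernel (pullbackAction φ) 0 t) : P x := by
  refine closure_minimal (fun y hy => ?_) closed hx
  change P y
  induction hy using Submodule.span_induction with
  | mem y hy =>
    obtain ⟨a, ha, z, rfl⟩ := hy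
    exact mem a (by simpa using ha) z
  | zero => exact zero
  | add y z _ _ hy hz => exact add y z hy hz
  | smul c y _ hy => exact smul c y hy

theorem isClosed_jetKernel (t : InvSpec A) :
    IsClosed (jetKernel (pullbackAction φ) 0 t : Set B) :=
  Submodule.isClosed_topologicalClosure _

theorem map_mul_mem_jetKernel {t : InvSpec A} {a : A} (ha : a ∈ charIdeal t) (y : B) :
    φ a * y ∈ jetKernel (pullbackAction φ) 0 t :=
  mem_jetKernel_of_mem_pow (pullbackAction φ) 0 (by simpa using ha) y

theorem jetKernel_mul_right_mem {t : InvSpec A} {x : B}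
    (hx : x ∈ jetKernel (pullbackAction φ) 0 t) (y : B) :
    x * y ∈ jetKernel (pullbackAction φ) 0 t := by
  refine jetKernel_pullback_induction (P := fun x => x * y ∈ jetKernel (pullbackAction φ) 0 t)
    (fun a ha z => ?_) (by simp) (fun x z hx hz => ?_) (fun c x hx => ?_)
    ((isClosed_jetKernel t).preimage (continuous_id.mul continuous_const)) hx
  · rw [mul_assoc]; exact map_mul_mem_jetKernel ha _
  · rw [add_mul]; exact add_mem hx hz
  · rw [smul_mul_assoc]; exact Submodule.smul_mem _ c hx

theorem jetKernel_mul_left_mem (hcenter : range φ ⊆ Set.center B) {t : InvSpec A} {x : B}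
    (hx : x ∈ jetKernel (pullbackAction φ) 0 t) (y : B) :
    y * x ∈ jetKernel (pullbackAction φ) 0 t := by
  refine jetKernel_pullback_induction (P := fun x => y * x ∈ jetKernel (pullbackAction φ) 0 t)
    (fun a ha z => ?_) (by simp) (fun x z hx hz => ?_) (fun c x hx => ?_)
    ((isClosed_jetKernel t).preimage (continuous_const.mul continuous_id)) hx
  · rw [← mul_assoc, ← ((hcenter ⟨a, rfl⟩).comm y).eq, mul_assoc]
    exact map_mul_mem_jetKernel ha _
  · rw [mul_add]; exact add_mem hx hz
  · rw [mul_smul_comm]; exact Submodule.smul_mem _ c hx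

/-- On generators, `(φ(a)y)* = φ(a*)y*` by centrality, and `I_t` is star-closed because `t` is
involutive. -/
theorem jetKernel_star_mem (hcenter : range φ ⊆ Set.center B) {t : InvSpec A} {x : B}
    (hx : x ∈ jetKernel (pullbackAction φ) 0 t) :
    star x ∈ jetKernel (pullbackAction φ) 0 t := by
  refine jetKernel_pullback_induction (P := fun x => star x ∈ jetKernel (pullbackAction φ) 0 t)
    (fun a ha z => ?_) (by simp) (fun x z hx hz => ?_) (fun c x hx => ?_)
    ((isClosed_jetKernel t).preimage continuous_star) hx
  · rw [star_mul, ← map_star, ← ((hcenter ⟨star a, rfl⟩).comm _).eq]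
    refine map_mul_mem_jetKernel ?_ _
    have ha' : t.1 a = 0 := ha
    change t.1 (star a) = 0
    rw [map_star, ha', star_zero]
  · rw [star_add]; exact add_mem hx hz
  · rw [star_smul]; exact Submodule.smul_mem _ _ hx

section Characters

variable {E : Type*} [CommCStarAlgebra E] {ι : E →⋆ₐ[ℂ] B} {ψ : A →⋆ₐ[ℂ] E}

/-- The restriction of a character along a continuous involutive homomorphism. -/
def InvSpec.ofCharacter (ψ : A →⋆ₐ[ℂ] E) (hψ : Continuous ψ) (k : WeakDual.characterSpace ℂ E) :
    InvSpec A :=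
  ⟨(k : E →⋆ₐ[ℂ] ℂ).comp ψ, (map_continuous k).comp hψ⟩

theorem InvSpec.ofCharacter_apply (hψ : Continuous ψ) (k : WeakDual.characterSpace ℂ E) (a : A) :
    (InvSpec.ofCharacter ψ hψ k).1 a = k (ψ a) := rfl

/-- On a generator `φ(a)y`, peak against `ψ(a)`, which `k` kills. For sums, multiply the two peaks,
which commute; limits survive because `‖e‖ ≤ 1`. Density of `ψ` is not required, so `E` may be
larger than the closure of `φ(A)`, as the norm estimate demands. -/
theorem exists_peak_jetKernel (hι : Isometry ι) (hιψ : ∀ a, ι (ψ a) = φ a) (hψ : Continuous ψ)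
    (k : WeakDual.characterSpace ℂ E) {x : B}
    (hx : x ∈ jetKernel (pullbackAction φ) 0 (InvSpec.ofCharacter ψ hψ k)) {δ : ℝ} (hδ : 0 < δ) :
    ∃ e : E, ‖e‖ ≤ 1 ∧ k e = 1 ∧ ‖ι e * x‖ ≤ δ := by
  have hn : ∀ e, ‖ι e‖ = ‖e‖ := fun e => hι.norm_map_of_map_zero (map_zero _) e
  refine jetKernel_pullback_induction
    (P := fun x => ∀ δ : ℝ, 0 < δ → ∃ e : E, ‖e‖ ≤ 1 ∧ k e = 1 ∧ ‖ι e * x‖ ≤ δ)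
    (fun a ha y δ hδ => ?_) (fun δ hδ => ?_) (fun x y hx hy δ hδ => ?_) (fun c x hx δ hδ => ?_)
    (isClosed_of_closure_subset fun x hx δ hδ => ?_) hx δ hδ
  · have hy : 0 < ‖y‖ + 1 := by positivity
    obtain ⟨e, he, hke, hea⟩ := CommCStarAlgebra.exists_peak k (u := ψ a) ha (div_pos hδ hy)
    refine ⟨e, he, hke, ?_⟩
    rw [← hιψ, ← mul_assoc, ← map_mul]
    calc ‖ι (e * ψ a) * y‖ ≤ ‖ι (e * ψ a)‖ * ‖y‖ := norm_mul_le _ _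
      _ ≤ δ / (‖y‖ + 1) * (‖y‖ + 1) := by rw [hn]; gcongr; linarith
      _ = δ := div_mul_cancel₀ _ hy.ne'
  · obtain ⟨e, he, hke, -⟩ := CommCStarAlgebra.exists_peak k (u := 0) (map_zero k) hδ
    exact ⟨e, he, hke, by simpa using hδ.le⟩
  · obtain ⟨e, he, hke, hex⟩ := hx _ (half_pos hδ)
    obtain ⟨f, hf, hkf, hfy⟩ := hy _ (half_pos hδ)
    refine ⟨e * f, (norm_mul_le _ _).trans (mul_le_one₀ he (norm_nonneg _) hf),
      by rw [map_mul, hke, hkf, one_mul], ?_⟩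
    have h1 : ‖ι f * (ι e * x)‖ ≤ δ / 2 := by
      refine (norm_mul_le _ _).trans ?_
      rw [hn]
      exact (mul_le_of_le_one_left (norm_nonneg _) hf).trans hex
    have h2 : ‖ι e * (ι f * y)‖ ≤ δ / 2 := by
      refine (norm_mul_le _ _).trans ?_
      rw [hn]
      exact (mul_le_of_le_one_left (norm_nonneg _) he).trans hfy
    have h3 : ι (e * f) * (x + y) = ι f * (ι e * x) + ι e * (ι f * y) := by
      rw [mul_add, ← mul_assoc, ← mul_assoc, ← map_mul, ← map_mul, mul_comm f e]
    rw [h3]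
    linarith [norm_add_le (ι f * (ι e * x)) (ι e * (ι f * y))]
  · have hc : 0 < ‖c‖ + 1 := by positivity
    obtain ⟨e, he, hke, hex⟩ := hx _ (div_pos hδ hc)
    refine ⟨e, he, hke, ?_⟩
    rw [mul_smul_comm, norm_smul]
    calc ‖c‖ * ‖ι e * x‖ ≤ (‖c‖ + 1) * (δ / (‖c‖ + 1)) := by gcongr; linarith
      _ = δ := mul_div_cancel₀ _ hc.ne'
  · obtain ⟨y, hy, hxy⟩ := Metric.mem_closure_iff.1 hx _ (half_pos hδ)
    obtain ⟨e, he, hke, hey⟩ := hy _ (half_pos hδ)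
    refine ⟨e, he, hke, ?_⟩
    have h1 : ‖ι e * (x - y)‖ ≤ δ / 2 := by
      refine (norm_mul_le _ _).trans ?_
      rw [hn, ← dist_eq_norm]
      exact (mul_le_of_le_one_left dist_nonneg he).trans hxy.le
    have h3 : ι e * x = ι e * (x - y) + ι e * y := by rw [← mul_add, sub_add_cancel]
    rw [h3]
    linarith [norm_add_le (ι e * (x - y)) (ι e * y)]

/-- Elements of the image of `E` act on the fibre over a character of `E` by its values. -/
theorem mul_sub_smul_mem_jetKernel (hι : Isometry ι) (hιψ : ∀ a, ι (ψ a) = φ a)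
    (hψ : Continuous ψ) (hd : DenseRange ψ) (k : WeakDual.characterSpace ℂ E) (e : E) (b : B) :
    ι e * b - k e • b ∈ jetKernel (pullbackAction φ) 0 (InvSpec.ofCharacter ψ hψ k) := by
  refine hd.induction_on e ?_ fun a => ?_
  · exact (isClosed_jetKernel _).preimage ((hι.continuous.mul continuous_const).sub
      ((map_continuous k).smul continuous_const))
  · have h := map_mul_mem_jetKernel (φ := φ)
      (sub_algebraMap_mem_charIdeal (InvSpec.ofCharacter ψ hψ k) a) b
    rwa [map_sub, AlgHomClass.commutes, sub_mul, ← Algebra.smul_def, ← hιψ,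
      InvSpec.ofCharacter_apply] at h

/-- If `ψ(I_t)` generated a proper ideal of `E`, a maximal ideal above it would give a character
restricting to `t`. So the ideal contains 1, and the fibre collapses. -/
theorem jetKernel_eq_top_of_notMem_range (hcenter : range φ ⊆ Set.center B)
    (hιψ : ∀ a, ι (ψ a) = φ a) (hψ : Continuous ψ) {t : InvSpec A}
    (ht : t ∉ range (InvSpec.ofCharacter ψ hψ)) (b : B) :
    b ∈ jetKernel (pullbackAction φ) 0 t := by
  have hmap : ∀ e ∈ Ideal.map ψ (charIdeal t), ι e ∈ jetKernel (pullbackAction φ) 0 t := by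
    intro e he
    induction he using Submodule.span_induction with
    | mem e he =>
      obtain ⟨a, ha, rfl⟩ := he
      rw [hιψ, ← mul_one (φ a)]
      exact map_mul_mem_jetKernel ha 1
    | zero => rw [map_zero]; exact zero_mem _
    | add e f _ _ he hf => rw [map_add]; exact add_mem he hf
    | smul c e _ he =>
      rw [smul_eq_mul, map_mul]
      exact jetKernel_mul_left_mem hcenter he _
  by_cases htop : Ideal.map ψ (charIdeal t) = ⊤
  · have h1 := jetKernel_mul_right_mem (hmap 1 (htop ▸ Submodule.mem_top)) b
    rwa [map_one, one_mul] at h1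
  · obtain ⟨M, hM, hle⟩ := Ideal.exists_le_maximal _ htop
    refine absurd ⟨M.toCharacterSpace, Subtype.ext (StarAlgHom.ext fun a => ?_)⟩ ht
    have h : M.toCharacterSpace (ψ (a - algebraMap ℂ A (t.1 a))) = 0 :=
      M.toCharacterSpace_apply_eq_zero_of_mem
        (hle (Ideal.mem_map_of_mem ψ (sub_algebraMap_mem_charIdeal t a)))
    rw [map_sub, map_sub, AlgHomClass.commutes, AlgHomClass.commutes, sub_eq_zero] at h
    exact h

/-- Characters are contractions and `ψ` maps totally bounded sets to totally bounded sets, so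
pointwise convergence on a finite net becomes uniform. -/
theorem InvSpec.continuous_ofCharacter [IsUniformAddGroup A] (hψ : Continuous ψ) :
    Continuous (InvSpec.ofCharacter ψ hψ) := by
  refine continuous_induced_rng.2 (continuous_iff_continuousAt.2 fun k => ?_)
  refine UniformOnFun.tendsto_iff_tendstoUniformlyOn.2 fun S hS => ?_
  refine Metric.tendstoUniformlyOn_iff.2 fun ε hε => ?_
  have huc : UniformContinuous ψ := uniformContinuous_addMonoidHom_of_continuous hψ
  obtain ⟨F, hF, hcov⟩ := Metric.totallyBounded_iff.1 (hS.image huc) (ε / 3) (by positivity)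
  have hev : ∀ᶠ l in 𝓝 k, ∀ e ∈ F, ‖k e - l e‖ < ε / 3 := by
    refine (eventually_all_finite hF).2 fun e _ => ?_
    have hc : Continuous fun l : WeakDual.characterSpace ℂ E => ‖k e - l e‖ :=
      (continuous_const.sub (map_continuous (gelfandStarTransform E e))).norm
    exact (hc.tendsto k).eventually_lt_const (by simpa using (by positivity : 0 < ε / 3))
  filter_upwards [hev] with l hl a ha
  obtain ⟨e, he, hae⟩ := mem_iUnion₂.1 (hcov (mem_image_of_mem ψ ha))
  rw [Metric.mem_ball, dist_eq_norm] at hae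
  change dist (k (ψ a)) (l (ψ a)) < ε
  rw [dist_eq_norm]
  have h1 := (CommCStarAlgebra.norm_character_apply_le k (ψ a - e)).trans_lt hae
  have h2 := (CommCStarAlgebra.norm_character_apply_le l (ψ a - e)).trans_lt hae
  have h3 : k (ψ a) - l (ψ a) = k (ψ a - e) + (k e - l e) - l (ψ a - e) := by
    rw [map_sub, map_sub]; ring
  rw [h3]
  linarith [norm_sub_le (k (ψ a - e) + (k e - l e)) (l (ψ a - e)),
    norm_add_le (k (ψ a - e)) (k e - l e), hl e he]

end Characters

end CentralHom

/-! ### Elements of B as continuous sections -/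

section Sections

universe u

variable {A : Type*} [CommRing A] [Algebra ℂ A] [StarRing A] [UniformSpace A]
variable {B : Type*} [CStarAlgebra B] {φ : A →⋆ₐ[ℂ] B}

theorem continuous_normSeminorm : Continuous (normSeminorm ℂ B) := continuous_norm

/-- The norm of a C⋆-algebra is bounded by the supremum of the fibre norms. -/
theorem norm_le_of_fiberSeminorm_le (hφ : Continuous φ) (hcenter : range φ ⊆ Set.center B)
    {b : B} {M : ℝ} (hM : 0 ≤ M)
    (h : ∀ t, fiberSeminorm (pullbackAction φ) 0 (normSeminorm ℂ B) t b ≤ M) : ‖b‖ ≤ M := by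
  cases subsingleton_or_nontrivial B with
  | inl _ => rwa [Subsingleton.elim b 0, norm_zero]
  | inr _ =>
  have hφc : ∀ (a : A) (y : B), φ a * y = y * φ a := fun a y => ((hcenter ⟨a, rfl⟩).comm y).eq
  -- Adjoining `b*b` keeps the algebra commutative and provides a character `k` with `|k(b*b)| =
  -- ‖b‖²`; its restriction to `A` is the point at which the fibre norm is tested.
  obtain ⟨E, _, ι, hι, hr⟩ := exists_commCStarAlgebra_adjoin (range φ ∪ {star b * b})
    (by
      rintro _ (⟨a, rfl⟩ | rfl)
      · exact Or.inl ⟨star a, map_star φ a⟩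
      · exact Or.inr (by simp))
    (by
      rintro _ (⟨a, rfl⟩ | rfl) _ (⟨c, rfl⟩ | rfl)
      · exact hφc _ _
      · exact hφc _ _
      · exact (hφc _ _).symm
      · rfl)
  have hsub : range φ ∪ {star b * b} ⊆ range ι :=
    hr ▸ (StarAlgebra.subset_adjoin ℂ _).trans subset_closure
  obtain ⟨ψ, hιψ⟩ := StarAlgHom.exists_lift ι hι.injective φ (subset_union_left.trans hsub)
  have hψ : Continuous ψ := hι.isEmbedding.continuous_iff.2 (by
    convert hφ using 1; exact funext hιψ)
  obtain ⟨u, hu⟩ := hsub (Or.inr rfl)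
  have hn : ∀ e, ‖ι e‖ = ‖e‖ := fun e => hι.norm_map_of_map_zero (map_zero _) e
  have : Nontrivial E := ⟨0, 1, fun h01 => zero_ne_one (α := B) (by
    rw [← map_zero ι, ← map_one ι, h01])⟩
  obtain ⟨k, hk⟩ := CommCStarAlgebra.exists_character_norm_eq u
  have hub : ‖u‖ = ‖b‖ * ‖b‖ := by rw [← hn, hu, CStarRing.norm_star_mul_self]
  refine le_of_forall_pos_lt_add fun ε hε => ?_
  obtain ⟨y, hy, hby⟩ := (fiberSeminorm_lt_iff (pullbackAction φ) 0 (normSeminorm ℂ B)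
    (InvSpec.ofCharacter ψ hψ k) b).1 ((h _).trans_lt (lt_add_of_pos_right M hε))
  change ‖b + y‖ < M + ε at hby
  have hz : star (b + y) * (b + y) - star b * b ∈
      jetKernel (pullbackAction φ) 0 (InvSpec.ofCharacter ψ hψ k) := by
    have : star (b + y) * (b + y) - star b * b = star (b + y) * y + star y * b := by
      rw [star_add]; noncomm_ring
    rw [this]
    exact add_mem (jetKernel_mul_left_mem hcenter hy _)
      (jetKernel_mul_right_mem (jetKernel_star_mem hcenter hy) _)
  -- The peak `e` makes the change from `b*b` to `(b+y)*(b+y)` negligible without changing the value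
  -- at `k`.
  have hle : ‖b‖ * ‖b‖ ≤ ‖b + y‖ * ‖b + y‖ := by
    refine le_of_forall_pos_le_add fun δ hδ => ?_
    obtain ⟨e, he, hke, hez⟩ := exists_peak_jetKernel hι hιψ hψ k hz hδ
    calc ‖b‖ * ‖b‖ = ‖k (e * u)‖ := by rw [map_mul, hke, one_mul, hk, hub]
      _ ≤ ‖ι (e * u)‖ := by rw [hn]; exact CommCStarAlgebra.norm_character_apply_le k _
      _ = ‖ι e * (star (b + y) * (b + y)) - ι e * (star (b + y) * (b + y) - star b * b)‖ := by
        rw [← mul_sub, sub_sub_cancel, map_mul, hu]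
      _ ≤ ‖ι e * (star (b + y) * (b + y))‖ + δ := (norm_sub_le _ _).trans (by gcongr)
      _ ≤ ‖b + y‖ * ‖b + y‖ + δ := by
        gcongr
        refine (norm_mul_le _ _).trans ?_
        rw [hn, CStarRing.norm_star_mul_self]
        exact mul_le_of_le_one_left (by positivity) he
  exact (abs_le_of_sq_le_sq' (by simpa [sq] using hle) (norm_nonneg _)).2.trans_lt hby

theorem eq_of_fiberSeminorm_sub_eq_zero (hφ : Continuous φ) (hcenter : range φ ⊆ Set.center B)
    {b c : B}
    (h : ∀ t, fiberSeminorm (pullbackAction φ) 0 (normSeminorm ℂ B) t (b - c) = 0) : b = c :=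
  sub_eq_zero.1 (norm_le_zero_iff.1
    (norm_le_of_fiberSeminorm_le hφ hcenter le_rfl fun t => (h t).le))

/-- Through the closure of its image, `φ` factors with dense range over a commutative
C⋆-algebra. -/
theorem exists_dense_factorization {B : Type u} [CStarAlgebra B] {φ : A →⋆ₐ[ℂ] B}
    (hφ : Continuous φ) (hcenter : range φ ⊆ Set.center B) :
    ∃ (E : Type u) (_ : CommCStarAlgebra E) (ι : E →⋆ₐ[ℂ] B) (ψ : A →⋆ₐ[ℂ] E),
      Isometry ι ∧ (∀ a, ι (ψ a) = φ a) ∧ Continuous ψ ∧ DenseRange ψ := by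
  obtain ⟨E, _, ι, hι, hr⟩ := exists_commCStarAlgebra_adjoin (range φ)
    (by rintro _ ⟨a, rfl⟩; exact ⟨star a, map_star φ a⟩)
    (by rintro _ ⟨a, rfl⟩ y -; exact ((hcenter ⟨a, rfl⟩).comm y).eq)
  have hadj : (StarAlgebra.adjoin ℂ (range φ) : Set B) = range φ :=
    SetLike.ext'_iff.1 (StarAlgebra.adjoin_eq φ.range)
  rw [hadj] at hr
  obtain ⟨ψ, hιψ⟩ := StarAlgHom.exists_lift ι hι.injective φ (hr ▸ subset_closure)
  have hcomp : ι ∘ ψ = φ := funext hιψ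
  refine ⟨E, _, ι, ψ, hι, hιψ, hι.isEmbedding.continuous_iff.2 (hcomp ▸ hφ), fun e => ?_⟩
  rw [hι.isEmbedding.closure_eq_preimage_closure_image, mem_preimage, ← range_comp, hcomp, ← hr]
  exact mem_range_self e

/-- A continuous family of fibre elements is approximated uniformly by an element. -/
theorem exists_fiberSeminorm_sub_le [IsUniformAddGroup A] (hφ : Continuous φ)
    (hcenter : range φ ⊆ Set.center B)
    (c : InvSpec A → B)
    (hc : ∀ (b : B) (ε : ℝ), 0 < ε →
      IsOpen {t | fiberSeminorm (pullbackAction φ) 0 (normSeminorm ℂ B) t (c t - b) < ε})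
    {ε : ℝ} (hε : 0 < ε) :
    ∃ b, ∀ t, fiberSeminorm (pullbackAction φ) 0 (normSeminorm ℂ B) t (c t - b) ≤ ε := by
  obtain ⟨E, _, ι, ψ, hι, hιψ, hψ, hd⟩ := exists_dense_factorization hφ hcenter
  let q := InvSpec.ofCharacter ψ hψ
  have hq : Continuous q := InvSpec.continuous_ofCharacter hψ
  -- On `U k` the single element `c (q k)` approximates the whole family within `ε`.
  let U : WeakDual.characterSpace ℂ E → Set (WeakDual.characterSpace ℂ E) := fun k =>
    q ⁻¹' {t | fiberSeminorm (pullbackAction φ) 0 (normSeminorm ℂ B) t (c t - c (q k)) < ε}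
  have hU : ∀ k, IsOpen (U k) := fun k => (hc _ ε hε).preimage hq
  have hmem : ∀ k, k ∈ U k := fun k => by
    change fiberSeminorm _ _ _ _ (c (q k) - c (q k)) < ε
    rw [sub_self, map_zero]
    exact hε
  obtain ⟨F, hF⟩ := isCompact_univ.elim_finite_subcover U hU
    fun k _ => mem_iUnion.2 ⟨k, hmem k⟩
  obtain ⟨f, hf⟩ := PartitionOfUnity.exists_isSubordinate isClosed_univ
    (fun i : F => U i) (fun i => hU i) (fun k hk => by
      obtain ⟨i, hi, hk⟩ := mem_iUnion₂.1 (hF hk)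
      exact mem_iUnion.2 ⟨⟨i, hi⟩, hk⟩)
  let g : F → E := fun i => (gelfandStarTransform E).symm
    ⟨fun k => (f i k : ℂ), Complex.continuous_ofReal.comp (map_continuous (f i))⟩
  have hg : ∀ (i : F) (k : WeakDual.characterSpace ℂ E), k (g i) = f i k := fun i k => by
    change gelfandStarTransform E (g i) k = _
    rw [StarAlgEquiv.apply_symm_apply]
    rfl
  refine ⟨∑ i, ι (g i) * c (q i), fun t => ?_⟩
  by_cases ht : t ∈ range q
  · obtain ⟨k, rfl⟩ := ht
    have hsum : ∑ i, f i k = 1 := by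
      rw [← finsum_eq_sum_of_fintype]
      exact f.sum_eq_one (mem_univ k)
    have hsumC : ∑ i, ((f i k : ℝ) : ℂ) = 1 := by exact_mod_cast hsum
    -- In the fibre over `q k` each `g i` acts as the scalar `f i k`, so the error is a convex
    -- combination of the local errors.
    have hsub : (c (q k) - ∑ i, ι (g i) * c (q i)) - ∑ i, (f i k : ℂ) • (c (q k) - c (q i))
        ∈ jetKernel (pullbackAction φ) 0 (q k) := by
      have : (c (q k) - ∑ i, ι (g i) * c (q i)) - ∑ i, (f i k : ℂ) • (c (q k) - c (q i))
          = -∑ i, (ι (g i) * c (q i) - k (g i) • c (q i)) := by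
        simp only [smul_sub, Finset.sum_sub_distrib, ← Finset.sum_smul, hsumC, hg, one_smul]
        abel
      rw [this]
      exact neg_mem (sum_mem fun i _ => mul_sub_smul_mem_jetKernel hι hιψ hψ hd k (g i) _)
    rw [fiberSeminorm_eq_of_sub_mem _ _ _ hsub]
    calc fiberSeminorm (pullbackAction φ) 0 (normSeminorm ℂ B) (q k)
          (∑ i, (f i k : ℂ) • (c (q k) - c (q i)))
        ≤ ∑ i, fiberSeminorm (pullbackAction φ) 0 (normSeminorm ℂ B) (q k)
          ((f i k : ℂ) • (c (q k) - c (q i))) := 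
          Finset.le_sum_of_subadditive _ (map_zero _).le (map_add_le_add _) _ _
      _ ≤ ∑ i, f i k * ε := by
        refine Finset.sum_le_sum fun i _ => ?_
        rw [map_smul_eq_mul, Complex.norm_real, Real.norm_of_nonneg (f.nonneg i k)]
        by_cases hk : f i k = 0
        · rw [hk, zero_mul, zero_mul]
        · exact mul_le_mul_of_nonneg_left
            (le_of_lt (hf i (subset_tsupport _ hk))) (f.nonneg i k)
      _ = ε := by rw [← Finset.sum_mul, hsum, one_mul]
  · rw [fiberSeminorm_eq_zero_of_mem _ _ _
      (jetKernel_eq_top_of_notMem_range hcenter hιψ hψ ht _)]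
    exact hε.le

/-- A continuous family of fibre elements comes from an element. -/
theorem exists_fiberSeminorm_sub_eq_zero [IsUniformAddGroup A] (hφ : Continuous φ)
    (hcenter : range φ ⊆ Set.center B)
    (c : InvSpec A → B)
    (hc : ∀ (b : B) (ε : ℝ), 0 < ε →
      IsOpen {t | fiberSeminorm (pullbackAction φ) 0 (normSeminorm ℂ B) t (c t - b) < ε}) :
    ∃ b, ∀ t, fiberSeminorm (pullbackAction φ) 0 (normSeminorm ℂ B) t (c t - b) = 0 := by
  choose b hb using fun N : ℕ => exists_fiberSeminorm_sub_le hφ hcenter c hc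
    (Nat.one_div_pos_of_nat (α := ℝ) (n := N))
  have hlim : Tendsto (fun N : ℕ => 2 * (1 / ((N : ℝ) + 1))) atTop (𝓝 0) := by
    simpa using (tendsto_one_div_add_atTop_nhds_zero_nat (𝕜 := ℝ)).const_mul 2
  -- Approximants close in every fibre are close in norm.
  have hcau : CauchySeq b := by
    refine cauchySeq_of_le_tendsto_0 _ (fun m l N hm hl => ?_) hlim
    rw [dist_eq_norm]
    refine norm_le_of_fiberSeminorm_le hφ hcenter (by positivity) fun t => ?_
    have h1 := (hb m t).trans (Nat.one_div_le_one_div hm)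
    have h2 := (hb l t).trans (Nat.one_div_le_one_div hl)
    have h3 := map_sub_le_add (fiberSeminorm (pullbackAction φ) 0 (normSeminorm ℂ B) t)
      (c t - b l) (c t - b m)
    rw [sub_sub_sub_cancel_left] at h3
    linarith
  obtain ⟨x, hx⟩ := cauchySeq_tendsto_of_complete hcau
  refine ⟨x, fun t => le_antisymm ?_ (apply_nonneg _ _)⟩
  have hlim' : Tendsto (fun N : ℕ => 1 / ((N : ℝ) + 1) + ‖b N - x‖) atTop (𝓝 0) := by
    simpa using tendsto_one_div_add_atTop_nhds_zero_nat.add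
      (tendsto_iff_norm_sub_tendsto_zero.1 hx)
  refine ge_of_tendsto' hlim' fun N => ?_
  have h1 := map_add_le_add (fiberSeminorm (pullbackAction φ) 0 (normSeminorm ℂ B) t)
    (c t - b N) (b N - x)
  rw [sub_add_sub_cancel] at h1
  have h2 := fiberSeminorm_le (pullbackAction φ) 0 (normSeminorm ℂ B) t (b N - x)
  change _ ≤ ‖b N - x‖ at h2
  linarith [hb N t]

/-- The fibre norm is the distance to a closed subspace, so it vanishes only on that subspace. -/
theorem jetAt_eq_iff_fiberSeminorm_sub (t : InvSpec A) (b c : B) :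
    jetAt (pullbackAction φ) 0 b t = jetAt (pullbackAction φ) 0 c t ↔
      fiberSeminorm (pullbackAction φ) 0 (normSeminorm ℂ B) t (b - c) = 0 := by
  constructor
  · intro h
    rw [← jetSeminorm_jetAt_sub _ _ continuous_normSeminorm, h, sub_self, ← jetAt_zero,
      jetSeminorm_jetAt _ _ continuous_normSeminorm]
    exact map_zero (fiberSeminorm (pullbackAction φ) 0 (normSeminorm ℂ B) t)
  · intro h
    refine jetAt_eq_of_sub_mem _ _ ?_
    rw [← SetLike.mem_coe, ← (isClosed_jetKernel t).closure_eq, Metric.mem_closure_iff]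
    intro ε hε
    obtain ⟨y, hy, hlt⟩ := (fiberSeminorm_lt_iff _ _ _ _ _).1 (h.trans_lt hε)
    refine ⟨-y, neg_mem hy, ?_⟩
    rw [dist_eq_norm, sub_neg_eq_add]
    exact hlt

theorem eq_of_forall_jetAt_eq (hφ : Continuous φ) (hcenter : range φ ⊆ Set.center B) {b c : B}
    (h : ∀ t, jetAt (pullbackAction φ) 0 b t = jetAt (pullbackAction φ) 0 c t) : b = c :=
  eq_of_fiberSeminorm_sub_eq_zero hφ hcenter fun t => (jetAt_eq_iff_fiberSeminorm_sub t b c).1 (h t)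

/-- Every continuous section of the bundle `J_A^0(B)` is the jet of an element of `B`. -/
theorem exists_jetAt_eq_of_continuous [IsUniformAddGroup A] (hφ : Continuous φ)
    (hcenter : range φ ⊆ Set.center B)
    (v : ∀ t : InvSpec A, JetFiber (pullbackAction φ) 0 t)
    (hv : Continuous fun t => (⟨t, v t⟩ : JetBundle (pullbackAction φ) 0)) :
    ∃ b : B, ∀ t, jetAt (pullbackAction φ) 0 b t = v t := by
  -- The representatives need not vary continuously; only the fibre seminorms of their differences
  -- from fixed elements are used.
  choose c hc using fun t => jetAt_surjective (pullbackAction φ) 0 t (v t)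
  obtain ⟨b, hb⟩ := exists_fiberSeminorm_sub_eq_zero hφ hcenter c fun b ε hε => by
    convert (isOpen_jetBasicOpen (pullbackAction φ) 0 b isOpen_univ
      continuous_normSeminorm hε).preimage hv using 1
    ext t
    simp [jetBasicOpen, ← hc, jetSeminorm_jetAt_sub _ _ continuous_normSeminorm]
  exact ⟨b, fun t => by rw [← hc, eq_comm, jetAt_eq_iff_fiberSeminorm_sub, hb]⟩

end Sections

end

/-! ### The operator attached to a bundle morphism -/

theorem mainTheorem9
    {A : Type*} [CommRing A] [Algebra ℂ A] [StarRing A] [StarModule ℂ A]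
    [UniformSpace A] [IsUniformAddGroup A] [ContinuousSMul ℂ A] [ContinuousStar A]
    (hA : IsStereotypeAlgebra A)
    {B : Type*} [CStarAlgebra B]
    (φ : A →⋆ₐ[ℂ] B) (hφ : Continuous φ)
    (hcenter : Set.range φ ⊆ Set.center B)
    (n : ℕ) (μ : JetBundleHom (selfAction A) n (pullbackAction φ) 0) :
    ∃! D : A →L[ℂ] B,
      IsDiffOp (selfAction A) (pullbackAction φ) n D ∧
        ∀ x : A, jet (pullbackAction φ) 0 (D x) = μ.toFun ∘ jet (selfAction A) n x := by
  have hμ : ∀ (x : A) t, μ.toFun (jet (selfAction A) n x t) =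
      ⟨t, μ.fiberMap t (jetAt (selfAction A) n x t)⟩ := fun x t => μ.toFun_mk t _
  have hcont := μ.continuous_toFun.comp (continuous_jet (selfAction A) n)
  choose d hd using fun x => exists_jetAt_eq_of_continuous hφ hcenter
    (fun t => μ.fiberMap t (jetAt (selfAction A) n x t))
    (by simpa only [Function.comp_def, hμ] using hcont.comp (Continuous.prodMk_right x))
  have hjet : Continuous fun z : A × InvSpec A => jet (pullbackAction φ) 0 (d z.1) z.2 := by
    convert hcont using 1
    funext z
    rw [Function.comp_apply, hμ, ← hd]
    rfl
  let L : A →ₗ[ℂ] B :=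
    { toFun := d
      map_add' := fun x y => eq_of_forall_jetAt_eq hφ hcenter fun t => by
        simp only [jetAt_add, hd, map_add]
      map_smul' := fun c x => eq_of_forall_jetAt_eq hφ hcenter fun t => by
        simp only [jetAt_smul, hd, map_smul, RingHom.id_apply] }
  have hL : Continuous L := by
    refine continuous_of_continuousAt_zero L ?_
    rw [ContinuousAt, map_zero, Metric.tendsto_nhds]
    intro ε hε
    obtain ⟨E, _, ι, ψ, hι, hιψ, hψ, hdense⟩ := exists_dense_factorization hφ hcenter
    let q := InvSpec.ofCharacter ψ hψ
    have hq : Continuous q := InvSpec.continuous_ofCharacter hψ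
    have ho : IsOpen {z : A × InvSpec A |
        fiberSeminorm (pullbackAction φ) 0 (normSeminorm ℂ B) z.2 (d z.1) < ε / 2} := by
      convert (isOpen_jetBasicOpen (pullbackAction φ) 0 0 isOpen_univ
        continuous_normSeminorm (half_pos hε)).preimage hjet using 1
      ext z
      simp [jet, jetBasicOpen, jetSeminorm_jetAt_sub _ _ continuous_normSeminorm]
    have hd0 : d 0 = 0 := map_zero L
    -- The estimate holds near each point `(0, k)`; compactness of the character space gives one
    -- neighbourhood of 0 valid for all `k`.
    have hev : ∀ᶠ x in 𝓝 (0 : A), ∀ k ∈ (univ : Set (WeakDual.characterSpace ℂ E)),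
        fiberSeminorm (pullbackAction φ) 0 (normSeminorm ℂ B) (q k) (d x) < ε / 2 := by
      refine isCompact_univ.eventually_forall_of_forall_eventually fun k _ => ?_
      refine (ho.preimage (continuous_fst.prodMk (hq.comp continuous_snd))).mem_nhds
        (x := ((0 : A), k)) ?_
      simp only [mem_preimage, mem_ofPred_eq, hd0, map_zero]
      exact half_pos hε
    filter_upwards [hev] with x hx
    rw [dist_zero_right]
    refine (norm_le_of_fiberSeminorm_le hφ hcenter (half_pos hε).le fun t => ?_).trans_lt
      (half_lt_self hε)
    by_cases ht : t ∈ range q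
    · obtain ⟨k, rfl⟩ := ht
      exact (hx k (mem_univ k)).le
    · rw [fiberSeminorm_eq_zero_of_mem _ _ _
        (jetKernel_eq_top_of_notMem_range hcenter hιψ hψ ht _)]
      exact (half_pos hε).le
  refine ⟨⟨L, hL⟩, ⟨fun l hl => ?_, fun x => ?_⟩, ?_⟩
  · ext x
    refine eq_of_forall_jetAt_eq hφ hcenter fun t => ?_
    obtain ⟨a, ha, h⟩ := foldl_moduleCommutator_sub_mem (selfAction A) (pullbackAction φ) t l L
    rw [hl] at ha
    -- The `n + 1` commutators put `a` in `I_t^{n+1}`, exactly the power killed by `n`-jets.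
    have hax : jetAt (selfAction A) n (selfAction A a x) t = jetAt (selfAction A) n 0 t :=
      jetAt_eq_of_sub_mem _ _ (by simpa using mem_jetKernel_of_mem_pow (selfAction A) n ha x)
    refine (jetAt_eq_of_sub_mem _ _ (h x)).trans ?_
    change jetAt (pullbackAction φ) 0 (d (selfAction A a x)) t = jetAt (pullbackAction φ) 0 0 t
    rw [hd, hax, ← hd, show d 0 = 0 from map_zero L]
  · funext t
    rw [Function.comp_apply, hμ, ← hd]
    rfl
  -- Uniqueness needs only the jets, which separate the elements of `B`.
  · rintro D' ⟨-, hD'⟩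
    ext x
    refine eq_of_forall_jetAt_eq hφ hcenter fun t => ?_
    have h := congrFun (hD' x) t
    rw [Function.comp_apply, hμ, ← hd] at h
    exact eq_of_heq (JetBundle.mk.inj h).2
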